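/- For a partition $\lambda=(\lambda_1\ge\lambda_2\ge\cdots\ge\lambda_m)$, write $\lambda\in\mathsf{Diff}_2^*$ if $\lambda_i-\lambda_{i+1}\ge 2$ for $1\le i<m$ and $1$ is not a part of $\lambda$. For such $\lambda$ let $col^*(\lambda)$ be the partition whose parts are the (nonzero) column lengths of the Ferrers diagram of $(\lambda_1-2m,\lambda_2-2(m-1),\dots,\lambda_m-2)$. **Theorem.** Let $N\ge 1$. The number of partitions of $N$ into parts congruent to $2$ or $3$ modulo $5$ with no $3$'s and no $8$'s is equal to the number of partitions $\lambda\in\mathsf{Diff}_2^*$ of $N$, with $m$ denoting the number of parts of $\lambda$, that satisfy one of the following: 1. $m\ge 8$, and $col^*(\lambda)$ has no $3$'s and no $8$'s; 2. $5\le m\le 7$, and $col^*(\lambda)$ has at most one $4$ and no $3$'s; 3. $m=4$, and $col^*(\lambda)$ has no $4$'s, at most two $3$'s, and its number $\ell$ of $1$'s satisfies $\ell\equiv 2,3$ or $4 \pmod 7$; 4. $m=3$, and $col^*(\lambda)$ has no $3$'s, and its number $\ell$ of $1$'s satisfies $\ell\not\equiv 3,4 \pmod 7$; 5. $m=2$,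 and $col^*(\lambda)$ has exactly one $1$; 6. $m=1$, and the single part of $\lambda$ is even. -/

import Mathlib

namespace RogersRamanujan

/-- The parts `λ₁ ≥ λ₂ ≥ ⋯ ≥ λₘ` of a partition, listed in weakly decreasing order. -/
def descParts {N : ℕ} (p : N.Partition) : List ℕ :=
  p.parts.sort (· ≥ ·)

/-- `Diff₂`: the consecutive differences `λᵢ - λᵢ₊₁` are at least two. -/
def IsDiff2 {N : ℕ} (p : N.Partition) : Prop :=
  (descParts p).IsChain (fun a b => b + 2 ≤ a)

/-- `Diff₂*`: the partitions in `Diff₂` that do not have `1` as a part. -/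
def IsDiff2Star {N : ℕ} (p : N.Partition) : Prop :=
  IsDiff2 p ∧ 1 ∉ p.parts

/-- The multiset of the (nonzero) column lengths of the Ferrers diagram with row lengths `μ`:
for `0 ≤ j < max μ`, the `j`-th column has one cell for each row of length `> j`. -/
def columns (μ : List ℕ) : Multiset ℕ :=
  ((List.range (μ.foldr max 0)).map fun j => μ.countP (fun a => j < a) : List ℕ)

/-- The sequence `(λ₁ - 2m, λ₂ - 2(m-1), …, λₘ - 2)`. For a partition in `Diff₂*` the
`i`-th part is at least `2(m+1-i)`, so no subtraction is truncated. -/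
def reducedParts {N : ℕ} (p : N.Partition) : List ℕ :=
  (descParts p).mapIdx fun i a => a - 2 * ((descParts p).length - i)

/-- `col*(λ)`: the partition (as a multiset of parts) formed by the columns of
`(λ₁ - 2m, …, λₘ - 2)`. It is used for `λ` in `Diff₂*` only. -/
def colStar {N : ℕ} (p : N.Partition) : Multiset ℕ :=
  columns (reducedParts p)

end RogersRamanujan

/-! Subtracting the staircase 2m, 2(m-1), ..., 2 from a partition in `Diff₂*` with m parts and
reading off columns gives an arbitrary multiset with elements in [1, m]. Hence these partitions have
generating function q^(m(m+1))/(q;q)_m, and restrictions on multiplicities in `col*` act factor by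
factor (`card_diff2Star_eq_coeff`). The second Rogers–Ramanujan identity (`sumSide_one`) says that
the sum over m ≥ 0 is the product of 1/(1-q^i) over i ≡ 2, 3 mod 5. Forbidding the parts 3 and 8
multiplies both sides by (1-q^3)(1-q^8).

This factor is then distributed over the sum. For m ≥ 8 it cancels two denominators. For 5 ≤ m ≤ 7
it cancels 1-q^3 and turns 1/(1-q^4) into 1+q^4 (`colSeries_mul`). For m ≤ 4 there is no termwise
match: at m = 0 the factor itself has negative coefficients. Only the total of these terms agrees,
by a rational function identity (`qprod_mul_initial`), which accounts for the conditions modulo 7.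

The Rogers–Ramanujan identity is proved where q is nilpotent, so all infinite sums and products are
finite. Both the sum side and a theta-like series satisfy the same second-order recursion in a
parameter and agree when it is large (`sumSide_eq_thetaTwo`); a finite Jacobi triple product
evaluates the theta series. -/

namespace RogersRamanujan

open Finset

/-! ### The second Rogers–Ramanujan identity for nilpotent q: recursions. -/

section QSeries

variable {R : Type*} [CommRing R]

/-- The triangular numbers. -/
def tri : ℕ → ℕ
  | 0 => 0
  | n + 1 => tri n + (n + 1)

/-- The product of `1 - q ^ k` over `a < k ≤ b`. -/
def qprod (q : R) (a b : ℕ) : R := ∏ k ∈ Ioc a b, (1 - q ^ k)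

@[simp] lemma qprod_self (q : R) (a : ℕ) : qprod q a a = 1 := by simp [qprod]

lemma qprod_succ_top (q : R) {a b : ℕ} (h : a ≤ b) :
    qprod q a (b + 1) = qprod q a b * (1 - q ^ (b + 1)) := by
  rw [qprod, qprod, Finset.prod_Ioc_succ_top h]

lemma qprod_mul (q : R) {a b c : ℕ} (h : a ≤ b) (h' : b ≤ c) :
    qprod q a b * qprod q b c = qprod q a c := by
  induction c, h' using Nat.le_induction with
  | base => simp
  | succ c hc ih => rw [qprod_succ_top q hc, qprod_succ_top q (h.trans hc), ← ih, mul_assoc]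

lemma qprod_succ_bot (q : R) {a b : ℕ} (h : a + 1 ≤ b) :
    qprod q a b = (1 - q ^ (a + 1)) * qprod q (a + 1) b := by
  rw [← qprod_mul q (Nat.le_succ a) h, qprod_succ_top q le_rfl, qprod_self, one_mul]

lemma qprod_eq_one {q : R} {N : ℕ} (hq : q ^ N = 0) {a b : ℕ} (h : N ≤ a + 1) :
    qprod q a b = 1 := by
  refine Finset.prod_eq_one fun k hk => ?_
  rw [pow_eq_zero_of_le (h.trans (by simp at hk; omega)) hq, sub_zero]

lemma qprod_eq_of_le {q : R} {N : ℕ} (hq : q ^ N = 0) {a b c : ℕ} (hab : a ≤ b) (hN : N ≤ b + 1)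
    (hbc : b ≤ c) : qprod q a c = qprod q a b := by
  rw [← qprod_mul q hab hbc, qprod_eq_one hq hN, mul_one]

lemma isUnit_qprod {q : R} {N : ℕ} (hq : q ^ N = 0) (a b : ℕ) : IsUnit (qprod q a b) := by
  refine Finset.prod_induction _ IsUnit (fun _ _ => IsUnit.mul) isUnit_one fun k hk => ?_
  refine IsNilpotent.isUnit_one_sub ⟨N, ?_⟩
  rw [← pow_mul, mul_comm, pow_mul, hq, zero_pow]
  simp at hk; omega

/-- The sum `∑ q ^ (n² + i n) / (q; q)ₙ`, truncated after `n = M` and multiplied by `(q; q)_M`. -/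
def sumSide (q : R) (M i : ℕ) : R := ∑ n ∈ range (M + 1), q ^ (n ^ 2 + i * n) * qprod q n M

/-- The difference of the n-th terms for i and i+1 carries a factor 1-q^n, which extends `qprod q n
M` downwards by one; shifting n gives the last sum, up to its top term, which vanishes by
nilpotency. -/
lemma sumSide_rec {q : R} {N : ℕ} (hq : q ^ N = 0) {M : ℕ} (hM : N ≤ M) (i : ℕ) :
    sumSide q M i = sumSide q M (i + 1) + q ^ (i + 1) * sumSide q M (i + 2) := by
  rw [← sub_eq_iff_eq_add', sumSide, sumSide, ← Finset.sum_sub_distrib, Finset.sum_range_succ',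
    sumSide, Finset.sum_range_succ, mul_add, Finset.mul_sum]
  have h : q ^ (i + 1) * (q ^ (M ^ 2 + (i + 2) * M) * qprod q M M) = 0 := by
    rw [← mul_assoc, ← pow_add, pow_eq_zero_of_le _ hq, zero_mul]
    nlinarith
  rw [h]
  simp only [mul_zero, sub_self, add_zero, ne_eq, OfNat.ofNat_ne_zero, not_false_eq_true, zero_pow]
  refine Finset.sum_congr rfl fun n hn => ?_
  rw [qprod_succ_bot q (a := n) (by simp at hn; omega)]
  ring

lemma sumSide_of_le {q : R} {N : ℕ} (hq : q ^ N = 0) (M : ℕ) {i : ℕ} (hi : N ≤ i) :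
    sumSide q M i = qprod q 0 M := by
  rw [sumSide, Finset.sum_range_succ', Finset.sum_eq_zero]
  · simp
  · intro n _
    rw [pow_eq_zero_of_le _ hq, zero_mul]
    nlinarith

/-- The `m = 2` series in the Rogers–Ramanujan recursion. -/
def thetaTwo (q : R) (M s : ℕ) : R :=
  ∑ r ∈ range M, (-1) ^ r * q ^ (2 * s * r + 2 * r ^ 2 + tri r) * (1 - q ^ (2 * s + 2 + 4 * r)) *
    qprod q r (r + s)

/-- The `m = 1` series in the Rogers–Ramanujan recursion. -/
def thetaOne (q : R) (M s : ℕ) : R :=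
  ∑ r ∈ range M, (-1) ^ r * q ^ (2 * s * r + 2 * r ^ 2 + r + tri r) * (1 - q ^ (s + 1 + 2 * r)) *
    qprod q r (r + s)

lemma qprod_shift (q : R) (r s : ℕ) :
    (1 - q ^ (r + 1)) * qprod q (r + 1) (r + 1 + s) = qprod q r (r + (s + 1)) := by
  rw [qprod_succ_bot q (a := r) (by omega), show r + 1 + s = r + (s + 1) by ring]

lemma qprod_top (q : R) (r s : ℕ) :
    qprod q r (r + s) * (1 - q ^ (r + s + 1)) = qprod q r (r + (s + 1)) := by
  rw [← qprod_succ_top q (by omega)]; rfl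

/-- Shifting the summation index, when the first term and the term after the last vanish. -/
lemma sum_range_eq_sum_range_succ {f : ℕ → R} {M : ℕ} (h0 : f 0 = 0) (hM : f M = 0) :
    ∑ r ∈ range M, f r = ∑ r ∈ range M, f (r + 1) := by
  have h := Finset.sum_range_succ' f M
  rw [Finset.sum_range_succ, h0, hM] at h
  simpa using h

/-- Split 1-q^(s+1+2r) = (1-q^r) + q^r(1-q^(r+s+1)). The second factor lengthens the product at the
top; the first does so at the bottom, after r is shifted by one. -/
lemma thetaOne_eq {q : R} {N : ℕ} (hq : q ^ N = 0) {M : ℕ} (hM : N ≤ M) (s : ℕ) :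
    thetaOne q M s = thetaTwo q M (s + 1) := by
  let f : ℕ → R := fun r =>
    (-1) ^ r * q ^ (2 * s * r + 2 * r ^ 2 + r + tri r) * ((1 - q ^ r) * qprod q r (r + s))
  have hf : ∑ r ∈ range M, f r = ∑ r ∈ range M, f (r + 1) := by
    refine sum_range_eq_sum_range_succ (by simp [f]) ?_
    simp only [f]
    rw [pow_eq_zero_of_le _ hq]
    · simp
    · nlinarith
  have h1 : thetaOne q M s = ∑ r ∈ range M, f r + ∑ r ∈ range M,
      (-1) ^ r * q ^ (2 * s * r + 2 * r ^ 2 + r + tri r) * q ^ r * qprod q r (r + (s + 1)) := by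
    rw [thetaOne, ← Finset.sum_add_distrib]
    refine Finset.sum_congr rfl fun r _ => ?_
    rw [← qprod_top]
    simp only [f]
    ring
  rw [h1, hf, ← Finset.sum_add_distrib, thetaTwo]
  refine Finset.sum_congr rfl fun r _ => ?_
  simp only [f]
  rw [qprod_shift, tri]
  ring

/-- Same mechanism as `thetaOne_eq`, with (1-q^(2s+2+4r)) - q^r(1-q^(s+1+2r)) = (1-q^r) +
q^(s+1+3r)(1-q^(r+s+1)). -/
lemma thetaTwo_eq {q : R} {N : ℕ} (hq : q ^ N = 0) {M : ℕ} (hM : N ≤ M) (s : ℕ) :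
    thetaTwo q M s = thetaOne q M s + q ^ (s + 1) * thetaOne q M (s + 1) := by
  let f : ℕ → R := fun r =>
    (-1) ^ r * q ^ (2 * s * r + 2 * r ^ 2 + tri r) * ((1 - q ^ r) * qprod q r (r + s))
  have hf : ∑ r ∈ range M, f r = ∑ r ∈ range M, f (r + 1) := by
    refine sum_range_eq_sum_range_succ (by simp [f]) ?_
    simp only [f]
    rw [pow_eq_zero_of_le _ hq]
    · simp
    · nlinarith
  have h1 : thetaTwo q M s - thetaOne q M s = ∑ r ∈ range M, f r + ∑ r ∈ range M,
      (-1) ^ r * q ^ (2 * s * r + 2 * r ^ 2 + tri r) * q ^ (s + 1 + 3 * r) *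
        qprod q r (r + (s + 1)) := by
    rw [thetaOne, thetaTwo, ← Finset.sum_add_distrib, ← Finset.sum_sub_distrib]
    refine Finset.sum_congr rfl fun r _ => ?_
    rw [← qprod_top]
    simp only [f]
    ring
  rw [← sub_eq_iff_eq_add', h1, hf, ← Finset.sum_add_distrib, thetaOne, Finset.mul_sum]
  refine Finset.sum_congr rfl fun r _ => ?_
  simp only [f]
  rw [qprod_shift, tri]
  ring

lemma thetaTwo_of_le {q : R} {N : ℕ} (hq : q ^ N = 0) {M : ℕ} (hM : 1 ≤ M) {s : ℕ} (hs : N ≤ s) :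
    thetaTwo q M s = qprod q 0 s := by
  obtain ⟨M, rfl⟩ := Nat.exists_eq_add_of_le' hM
  rw [thetaTwo, Finset.sum_range_succ', Finset.sum_eq_zero]
  · rw [pow_eq_zero_of_le (show N ≤ 2 * s + 2 + 4 * 0 by omega) hq]
    simp [tri]
  · intro n _
    rw [pow_eq_zero_of_le (n := 2 * s * (n + 1) + 2 * (n + 1) ^ 2 + tri (n + 1)) _ hq]
    · simp
    · nlinarith

theorem sumSide_eq_thetaTwo {q : R} {N : ℕ} (hq : q ^ N = 0) {M : ℕ} (hM : N ≤ M) (hM1 : 1 ≤ M)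
    (i : ℕ) : sumSide q M i = thetaTwo q M i := by
  have hrec : ∀ s, thetaTwo q M s =
      thetaTwo q M (s + 1) + q ^ (s + 1) * thetaTwo q M (s + 2) := fun s => by
    rw [thetaTwo_eq hq hM, thetaOne_eq hq hM, thetaOne_eq hq hM]
  have hlarge : ∀ i, N ≤ i → sumSide q M i = thetaTwo q M i := fun i hi => by
    rw [sumSide_of_le hq M hi, thetaTwo_of_le hq hM1 hi,
      qprod_eq_of_le hq (Nat.zero_le N) (Nat.le_succ N) hM,
      qprod_eq_of_le hq (Nat.zero_le N) (Nat.le_succ N) hi]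
  -- Descending induction from large indices; the recursion has order two, so two consecutive values
  -- are carried.
  have key : ∀ d i, N ≤ i + d →
      sumSide q M i = thetaTwo q M i ∧ sumSide q M (i + 1) = thetaTwo q M (i + 1) := by
    intro d
    induction d with
    | zero => exact fun i hi => ⟨hlarge i hi, hlarge _ (by omega)⟩
    | succ d ih =>
      intro i hi
      obtain ⟨h1, h2⟩ := ih (i + 1) (by omega)
      exact ⟨by rw [sumSide_rec hq hM, hrec, h1, h2], h1⟩
  exact (key N i (by omega)).1

/-! ### Gaussian binomials and the finite triple product. -/

/-- The Gaussian binomial coefficient. -/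
def gauss (q : R) : ℕ → ℕ → R
  | _, 0 => 1
  | 0, _ + 1 => 0
  | n + 1, k + 1 => gauss q n k + q ^ (k + 1) * gauss q n (k + 1)

@[simp] lemma gauss_zero_right (q : R) (n : ℕ) : gauss q n 0 = 1 := by cases n <;> rfl

lemma gauss_succ_succ (q : R) (n k : ℕ) :
    gauss q (n + 1) (k + 1) = gauss q n k + q ^ (k + 1) * gauss q n (k + 1) := rfl

lemma gauss_eq_zero (q : R) {n k : ℕ} (h : n < k) : gauss q n k = 0 := by
  induction n generalizing k with
  | zero => obtain ⟨k, rfl⟩ := Nat.exists_eq_add_of_lt h; simp [gauss]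
  | succ n ih =>
    obtain ⟨k, rfl⟩ := Nat.exists_eq_add_of_le' (show 1 ≤ k by omega)
    rw [gauss_succ_succ, ih (by omega), ih (by omega)]; simp

lemma map_gauss {S : Type*} [CommRing S] (φ : R →+* S) (q : R) (n k : ℕ) :
    φ (gauss q n k) = gauss (φ q) n k := by
  induction n generalizing k with
  | zero => cases k <;> simp [gauss]
  | succ n ih => cases k <;> simp [gauss_succ_succ, ih]

/-- The quotient formula for Gaussian binomials, cleared of denominators; the Pascal rule matches
1-q^(a+b) = (1-q^a) + q^a(1-q^b). -/
lemma gauss_mul (q : R) (a b : ℕ) :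
    gauss q (a + b) a * (qprod q 0 a * qprod q 0 b) = qprod q 0 (a + b) := by
  obtain ⟨n, hn⟩ : ∃ n, n = a + b := ⟨_, rfl⟩
  induction n generalizing a b with
  | zero =>
    obtain ⟨rfl, rfl⟩ : a = 0 ∧ b = 0 := by omega
    simp
  | succ n ih =>
    rcases a with _ | a
    · simp
    rw [show a + 1 + b = n + 1 by omega, gauss_succ_succ, qprod_succ_top q (Nat.zero_le n),
      qprod_succ_top q (Nat.zero_le a)]
    have h1 := ih a b (by omega)
    rw [show a + b = n by omega] at h1
    rcases b with _ | b
    · rw [gauss_eq_zero q (show n < a + 1 by omega), ← h1, show n = a by omega]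
      simp
      ring
    · have h2 := ih (a + 1) b (by omega)
      rw [show a + 1 + b = n by omega, qprod_succ_top q (Nat.zero_le a)] at h2
      rw [qprod_succ_top q (Nat.zero_le b)] at h1 ⊢
      rw [show n + 1 = (a + 1) + (b + 1) by omega, pow_add q (a + 1) (b + 1)]
      linear_combination (1 - q ^ (a + 1)) * h1 + q ^ (a + 1) * (1 - q ^ (b + 1)) * h2

/-- The finite `q`-binomial theorem. -/
lemma prod_add_mul_pow (q x y : R) (n : ℕ) :
    ∏ i ∈ range n, (y + x * q ^ i) =
      ∑ k ∈ range (n + 1), q ^ (k.choose 2) * gauss q n k * x ^ k * y ^ (n - k) := by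
  induction n generalizing x with
  | zero => simp
  | succ n ih =>
    have h := ih (x * q)
    rw [Finset.prod_range_succ']
    have h' : ∏ i ∈ range n, (y + x * q ^ (i + 1)) = ∏ i ∈ range n, (y + x * q * q ^ i) :=
      Finset.prod_congr rfl fun i _ => by ring
    rw [h', h, pow_zero, mul_one, mul_add, Finset.sum_range_succ' _ (n + 1)]
    have h1 : (∑ k ∈ range (n + 1), q ^ (k.choose 2) * gauss q n k * (x * q) ^ k * y ^ (n - k)) * y
        = ∑ k ∈ range (n + 1), q ^ ((k + 1).choose 2) * (q ^ (k + 1) * gauss q n (k + 1)) *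
          x ^ (k + 1) * y ^ (n + 1 - (k + 1)) + y ^ (n + 1) := by
      rw [Finset.sum_range_succ', Finset.sum_range_succ _ n, gauss_eq_zero q (Nat.lt_succ_self n),
        add_mul, Finset.sum_mul]
      simp only [Nat.choose_zero_succ, pow_zero, gauss_zero_right, Nat.sub_zero, mul_one, mul_zero,
        zero_mul, add_zero, one_mul, ← pow_succ]
      congr 1
      refine Finset.sum_congr rfl fun k hk => ?_
      have hk' : k < n := by simpa using hk
      rw [show n + 1 - (k + 1) = (n - (k + 1)) + 1 by omega]
      ring
    rw [h1]
    simp only [gauss_succ_succ]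
    rw [Finset.sum_mul, add_right_comm, ← Finset.sum_add_distrib]
    congr 1
    · refine Finset.sum_congr rfl fun k hk => ?_
      rw [Nat.choose_succ_succ' k 1, Nat.choose_one_right, Nat.add_sub_add_right]
      ring
    · simp

lemma two_mul_tri (r : ℕ) : 2 * tri r = r * (r + 1) := by
  induction r with
  | zero => rfl
  | succ r ih => rw [tri, mul_add, ih]; ring

lemma two_mul_choose_two (k : ℕ) : 2 * k.choose 2 + k = k * k := by
  induction k with
  | zero => rfl
  | succ k ih =>
    rw [Nat.choose_succ_succ' k 1, Nat.choose_one_right]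
    linarith

/-- A finite form of the Jacobi triple product for the modulus `5`, before cancellation of the
leading power of `q`. -/
lemma finite_triple_product_aux (q : R) (m : ℕ) :
    q ^ (5 * (m + 1).choose 2 + (5 * m + 4) * (m + 2)) *
      ((∏ i ∈ range (m + 1), (1 - q ^ (5 * i + 4))) * ∏ i ∈ range (m + 2), (1 - q ^ (5 * i + 1))) =
    q ^ (5 * (m + 1).choose 2 + (5 * m + 4) * (m + 2)) *
      ∑ r ∈ range (m + 2), (-1) ^ r * q ^ (2 * r ^ 2 + r + tri r) *
        (gauss (q ^ 5) (2 * m + 3) (m + 1 - r) -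
          q ^ (2 * r + 1) * gauss (q ^ 5) (2 * m + 3) (m + 2 + r)) := by
  -- The factors q^(5m+4) - q^(5i) yield 1-q^(5j+4) for i ≤ m and 1-q^(5j+1) for i > m. The
  -- two-variable form of the q-binomial theorem avoids negative powers of q. On the sum side, the
  -- indices m+1-r and m+2+r are paired.
  have h := prod_add_mul_pow (q ^ 5) (-1) (q ^ (5 * m + 4)) (2 * m + 3)
  rw [show 2 * m + 3 = (m + 1) + (m + 2) by ring, Finset.prod_range_add,
    show (m + 1) + (m + 2) + 1 = (m + 2) + (m + 2) by ring, Finset.sum_range_add,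
    ← Finset.prod_range_reflect, ← Finset.sum_range_reflect _ (m + 2),
    ← Finset.sum_add_distrib] at h
  have h1 : ∏ j ∈ range (m + 1), (q ^ (5 * m + 4) + -1 * (q ^ 5) ^ (m + 1 - 1 - j)) =
      (-1) ^ (m + 1) * q ^ (5 * (m + 1).choose 2) * ∏ i ∈ range (m + 1), (1 - q ^ (5 * i + 4)) := by
    have : ∀ j ∈ range (m + 1), q ^ (5 * m + 4) + -1 * (q ^ 5) ^ (m + 1 - 1 - j) =
        -1 * (q ^ 5) ^ (m + 1 - 1 - j) * (1 - q ^ (5 * j + 4)) := by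
      intro j hj
      obtain ⟨t, rfl⟩ := Nat.exists_eq_add_of_le' (show j ≤ m by simp at hj; omega)
      rw [show t + j + 1 - 1 - j = t by omega]
      ring
    rw [Finset.prod_congr rfl this, Finset.prod_mul_distrib, Finset.prod_mul_distrib,
      Finset.prod_range_reflect (fun j => (q ^ 5) ^ j) (m + 1), Finset.prod_pow_eq_pow_sum,
      Finset.sum_range_id, ← Nat.choose_two_right, Finset.prod_const, Finset.card_range, pow_mul]
  have h2 : ∏ j ∈ range (m + 2), (q ^ (5 * m + 4) + -1 * (q ^ 5) ^ (m + 1 + j)) =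
      q ^ ((5 * m + 4) * (m + 2)) * ∏ i ∈ range (m + 2), (1 - q ^ (5 * i + 1)) := by
    rw [pow_mul, ← Finset.card_range (m + 2), ← Finset.prod_const, Finset.card_range,
      ← Finset.prod_mul_distrib]
    exact Finset.prod_congr rfl fun j _ => by ring
  rw [h1, h2] at h
  have hsq : (-1 : R) ^ (m + 1) * (-1) ^ (m + 1) = 1 := by
    rw [← mul_pow]; simp
  have h3 : q ^ (5 * (m + 1).choose 2 + (5 * m + 4) * (m + 2)) *
      ((∏ i ∈ range (m + 1), (1 - q ^ (5 * i + 4))) * ∏ i ∈ range (m + 2), (1 - q ^ (5 * i + 1))) =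
      (-1) ^ (m + 1) * ((-1) ^ (m + 1) * q ^ (5 * (m + 1).choose 2) *
        (∏ i ∈ range (m + 1), (1 - q ^ (5 * i + 4))) *
        (q ^ ((5 * m + 4) * (m + 2)) * ∏ i ∈ range (m + 2), (1 - q ^ (5 * i + 1)))) := by
    rw [pow_add]
    linear_combination -(q ^ (5 * (m + 1).choose 2) * q ^ ((5 * m + 4) * (m + 2)) *
      ((∏ i ∈ range (m + 1), (1 - q ^ (5 * i + 4))) *
        ∏ i ∈ range (m + 2), (1 - q ^ (5 * i + 1)))) * hsq
  rw [h3, h, Finset.mul_sum, Finset.mul_sum]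
  refine Finset.sum_congr rfl fun r hr => ?_
  obtain ⟨t, ht⟩ := Nat.exists_eq_add_of_le' (show r ≤ m + 1 by simp at hr; omega)
  rw [show m + 2 - 1 - r = t by omega, show m + 1 - r = t by omega,
    show m + 1 + (m + 2) - t = m + 2 + r by omega,
    show m + 1 + (m + 2) - (m + 2 + r) = t by omega, ← pow_mul, ← pow_mul, ← pow_mul, ← pow_mul]
  have e1 : 5 * t.choose 2 + (5 * m + 4) * (m + 2 + r) =
      5 * (m + 1).choose 2 + (5 * m + 4) * (m + 2) + (2 * r ^ 2 + r + tri r) := by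
    have a1 := two_mul_choose_two t
    have a2 := two_mul_choose_two (m + 1)
    have a3 := two_mul_tri r
    zify at *
    have ht' : (t : ℤ) = m + 1 - r := by linarith
    rw [ht'] at a1
    linarith
  have e2 : 5 * (m + 2 + r).choose 2 + (5 * m + 4) * t =
      5 * (m + 1).choose 2 + (5 * m + 4) * (m + 2) + (2 * r ^ 2 + r + tri r) + (2 * r + 1) := by
    have a1 := two_mul_choose_two (m + 2 + r)
    have a2 := two_mul_choose_two (m + 1)
    have a3 := two_mul_tri r
    zify at *
    have ht' : (t : ℤ) = m + 1 - r := by linarith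
    rw [ht']
    linarith
  have s1 : (-1 : R) ^ (m + 1) * (-1) ^ t = (-1) ^ r := by
    rw [ht, pow_add, mul_right_comm, ← mul_pow]; simp
  have s2 : (-1 : R) ^ (m + 1) * (-1) ^ (m + 2 + r) = -(-1) ^ r := by
    rw [show m + 2 + r = (m + 1) + (r + 1) by ring, pow_add _ (m + 1),
      ← mul_assoc, hsq]; ring
  generalize 5 * (m + 1).choose 2 + (5 * m + 4) * (m + 2) = D at *
  generalize 2 * r ^ 2 + r + tri r = e at *
  have p1 : q ^ (5 * t.choose 2) * q ^ ((5 * m + 4) * (m + 2 + r)) = q ^ D * q ^ e := by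
    rw [← pow_add, ← pow_add, e1]
  have p2 : q ^ (5 * (m + 2 + r).choose 2) * q ^ ((5 * m + 4) * t) =
      q ^ D * q ^ e * q ^ (2 * r + 1) := by
    rw [← pow_add, ← pow_add, ← pow_add, e2]
  generalize q ^ (5 * t.choose 2) = a at *
  generalize q ^ ((5 * m + 4) * (m + 2 + r)) = b at *
  generalize q ^ (5 * (m + 2 + r).choose 2) = c at *
  generalize q ^ ((5 * m + 4) * t) = d at *
  generalize (-1 : R) ^ (m + 1) = u at *
  generalize (-1 : R) ^ (m + 2 + r) = v at *
  rw [show 2 * m + 3 = m + 1 + (m + 2) by ring]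
  generalize gauss (q ^ 5) (m + 1 + (m + 2)) t = g₁
  generalize gauss (q ^ 5) (m + 1 + (m + 2)) (m + 2 + r) = g₂
  linear_combination g₁ * a * b * s1 + g₂ * c * d * s2 + (-1) ^ r * g₁ * p1 -
    (-1) ^ r * g₂ * p2

open Polynomial in
/-- A finite form of the Jacobi triple product for the modulus `5`. -/
lemma finite_triple_product (q : R) (m : ℕ) :
    (∏ i ∈ range (m + 1), (1 - q ^ (5 * i + 4))) * ∏ i ∈ range (m + 2), (1 - q ^ (5 * i + 1)) =
      ∑ r ∈ range (m + 2), (-1) ^ r * q ^ (2 * r ^ 2 + r + tri r) *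
        (gauss (q ^ 5) (2 * m + 3) (m + 1 - r) -
          q ^ (2 * r + 1) * gauss (q ^ 5) (2 * m + 3) (m + 2 + r)) := by
  -- A nilpotent q cannot be cancelled, so the power is cancelled in ℤ[X] and the result
  -- specialised.
  have h := mul_left_cancel₀ (pow_ne_zero _ X_ne_zero) (finite_triple_product_aux (X : ℤ[X]) m)
  have h' := congrArg (Polynomial.eval₂RingHom (Int.castRingHom R) q) h
  have hX : Polynomial.eval₂RingHom (Int.castRingHom R) q X = q := by simp
  simpa only [map_mul, map_sum, map_prod, map_sub, map_pow, map_neg, map_one, map_gauss, hX]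
    using h'

/-- The limit 1/(q;q)_∞ of central Gaussian binomials: once the indices reach N, every product in
`gauss_mul` has stabilised. -/
lemma gauss_mul_qprod {q : R} {N : ℕ} (hq : q ^ N = 0) {a b M : ℕ} (ha : N ≤ a) (hb : N ≤ b)
    (hM : N ≤ M) : gauss q (a + b) a * qprod q 0 M = 1 := by
  have h := gauss_mul q a b
  rw [qprod_eq_of_le hq (Nat.zero_le N) (Nat.le_succ N) ha,
    qprod_eq_of_le hq (Nat.zero_le N) (Nat.le_succ N) hb,
    qprod_eq_of_le hq (Nat.zero_le N) (Nat.le_succ N) (show N ≤ a + b by omega), ← mul_assoc] at h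
  rw [qprod_eq_of_le hq (Nat.zero_le N) (Nat.le_succ N) hM]
  exact (isUnit_qprod hq 0 N).mul_right_cancel (by rw [h, one_mul])

lemma thetaOne_zero {q : R} {N : ℕ} (hq : q ^ N = 0) {M K : ℕ} (hM : N ≤ M) (hK : 2 * N ≤ K) :
    thetaOne q M 0 = (∏ i ∈ range (K + 1), (1 - q ^ (5 * i + 4))) *
      (∏ i ∈ range (K + 2), (1 - q ^ (5 * i + 1))) * qprod (q ^ 5) 0 M := by
  have hq5 : (q ^ 5) ^ N = 0 := by rw [← pow_mul, mul_comm, pow_mul, hq, zero_pow (by norm_num)]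
  have hvan : ∀ r, N ≤ r → q ^ (2 * r ^ 2 + r + tri r) = 0 := fun r hr =>
    pow_eq_zero_of_le (by nlinarith) hq
  rw [finite_triple_product, Finset.sum_mul, thetaOne,
    ← Finset.sum_subset (Finset.range_subset_range.2 hM),
    ← Finset.sum_subset (Finset.range_subset_range.2 (show N ≤ K + 2 by omega))]
  · refine Finset.sum_congr rfl fun r hr => ?_
    have hr' : r < N := by simpa using hr
    -- Since r < N, the bound 2N ≤ K keeps both indices at least N.
    have g1 := gauss_mul_qprod hq5 (show N ≤ K + 1 - r by omega) (show N ≤ K + 2 + r by omega) hM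
    have g2 := gauss_mul_qprod hq5 (show N ≤ K + 2 + r by omega) (show N ≤ K + 1 - r by omega) hM
    rw [show K + 1 - r + (K + 2 + r) = 2 * K + 3 by omega] at g1
    rw [show K + 2 + r + (K + 1 - r) = 2 * K + 3 by omega] at g2
    rw [add_zero, qprod_self, mul_zero, zero_mul, zero_add, zero_add]
    linear_combination (-1) ^ r * q ^ (2 * r ^ 2 + r + tri r) *
      (q ^ (2 * r + 1) * g2 - g1)
  · intro r _ hr
    rw [hvan r (by simpa using hr)]; simp
  · intro r _ hr
    rw [show 2 * 0 * r + 2 * r ^ 2 + r + tri r = 2 * r ^ 2 + r + tri r by ring,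
      hvan r (by simpa using hr)]; simp

/-- The second Rogers–Ramanujan identity, truncated by the nilpotency of `q`. -/
theorem sumSide_one {q : R} {N : ℕ} (hq : q ^ N = 0) {M K : ℕ} (hM : N ≤ M) (hM1 : 1 ≤ M)
    (hK : 2 * N ≤ K) :
    sumSide q M 1 = (∏ i ∈ range (K + 1), (1 - q ^ (5 * i + 4))) *
      (∏ i ∈ range (K + 2), (1 - q ^ (5 * i + 1))) * qprod (q ^ 5) 0 M := by
  rw [sumSide_eq_thetaTwo hq hM hM1, ← thetaOne_eq hq hM, thetaOne_zero hq hM hK]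

end QSeries

/-! ### Generating functions of multisets with prescribed multiplicities. -/

section Counting

open Classical in
/-- The generating series of the multisets whose only element is `i`, with the multiplicity
satisfying `C`. -/
noncomputable def partSeries (i : ℕ) (C : ℕ → Prop) : PowerSeries ℤ :=
  PowerSeries.mk fun t => if i ∣ t ∧ C (t / i) then 1 else 0

/-- The multisets with elements in `[1, m]` and with sum `n` where the multiplicity of `i`
satisfies `C i`. -/
def restrictedMultisets (m n : ℕ) (C : ℕ → ℕ → Prop) : Set (Multiset ℕ) :=
  {c | (∀ a ∈ c, a ∈ Icc 1 m) ∧ c.sum = n ∧ ∀ i ∈ Icc 1 m, C i (c.count i)}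

lemma count_sum_replicate (s : Finset ℕ) (f : ℕ → ℕ) (i : ℕ) :
    (∑ j ∈ s, Multiset.replicate (f j) j).count i = if i ∈ s then f i else 0 := by
  rw [Multiset.count_sum']
  simp [Multiset.count_replicate]

theorem ncard_restrictedMultisets (m n : ℕ) (C : ℕ → ℕ → Prop) :
    ((restrictedMultisets m n C).ncard : ℤ) =
      PowerSeries.coeff n (∏ i ∈ Icc 1 m, partSeries i (C i)) := by
  classical
  rw [PowerSeries.coeff_prod]
  simp only [partSeries, PowerSeries.coeff_mk, Finset.prod_ite_zero, Finset.prod_const_one,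
    Finset.sum_boole]
  rw [Nat.cast_inj, ← Set.ncard_coe_finset]
  refine Set.ncard_congr
    (fun c _ => Finsupp.onFinset c.toFinset (fun i => i * c.count i) fun i hi => ?_) ?_ ?_ ?_
  · rw [Multiset.mem_toFinset, ← Multiset.count_ne_zero]
    exact right_ne_zero_of_mul hi
  · rintro c ⟨h1, h2, h3⟩
    have hsub : c.toFinset ⊆ Icc 1 m := fun i hi => h1 i (by simpa using hi)
    simp only [coe_filter, Set.mem_ofPred_eq, mem_finsuppAntidiag, Finsupp.onFinset_apply]
    refine ⟨⟨?_, fun i hi => ?_⟩, fun i hi => ⟨dvd_mul_right _ _, ?_⟩⟩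
    · rw [← h2, Finset.sum_multiset_count_of_subset c _ hsub]
      exact Finset.sum_congr rfl fun i _ => by
        rw [smul_eq_mul, mul_comm, Finsupp.onFinset_apply]
    · exact hsub (Finsupp.support_onFinset_subset hi)
    · rw [Nat.mul_div_cancel_left _ (by simp at hi; omega)]
      exact h3 i hi
  · rintro c c' ⟨h1, -, -⟩ ⟨h1', -, -⟩ h
    ext i
    -- The encoding i ↦ i · count loses the multiplicity of 0, which is zero by the bounds on the
    -- elements.
    rcases Nat.eq_zero_or_pos i with rfl | hi
    · rw [Multiset.count_eq_zero_of_notMem fun h0 => by simpa using h1 0 h0,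
        Multiset.count_eq_zero_of_notMem fun h0 => by simpa using h1' 0 h0]
    · have := DFunLike.congr_fun h i
      simp only [Finsupp.onFinset_apply] at this
      exact Nat.eq_of_mul_eq_mul_left hi this
  · intro l hl
    simp only [coe_filter, Set.mem_ofPred_eq, mem_finsuppAntidiag] at hl
    obtain ⟨⟨h1, h2⟩, h3⟩ := hl
    have hcount := count_sum_replicate (Icc 1 m) fun i => l i / i
    refine ⟨∑ i ∈ Icc 1 m, Multiset.replicate (l i / i) i, ⟨fun a ha => ?_, ?_, fun i hi => ?_⟩, ?_⟩
    · by_contra hn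
      rw [← Multiset.count_ne_zero, hcount, if_neg hn] at ha
      exact ha rfl
    · rw [Multiset.sum_sum, ← h1]
      exact Finset.sum_congr rfl fun i hi => by
        rw [Multiset.sum_replicate, smul_eq_mul, Nat.div_mul_cancel (h3 i hi).1]
    · rw [hcount, if_pos hi]
      exact (h3 i hi).2
    · ext i
      rw [Finsupp.onFinset_apply, hcount]
      split_ifs with hi
      · exact Nat.mul_div_cancel' (h3 i hi).1
      · rw [mul_zero, eq_comm, ← Finsupp.notMem_support_iff]
        exact fun h => hi (h2 h)

theorem card_partitions_eq_coeff {N M : ℕ} (hM : N ≤ M) (C : ℕ → ℕ → Prop)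
    {P : N.Partition → Prop} (hP : ∀ p, P p ↔ ∀ i ∈ Icc 1 M, C i (p.parts.count i)) :
    (Nat.card {p : N.Partition // P p} : ℤ) =
      PowerSeries.coeff N (∏ i ∈ Icc 1 M, partSeries i (C i)) := by
  rw [← ncard_restrictedMultisets, Nat.cast_inj, ← Nat.card_coe_set_eq]
  refine Nat.card_eq_of_bijective
    (fun p => ⟨p.1.parts, fun a ha => ?_, p.1.parts_sum, (hP _).1 p.2⟩) ⟨?_, ?_⟩
  · exact Finset.mem_Icc.2 ⟨p.1.parts_pos ha, (p.1.le_of_mem_parts ha).trans hM⟩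
  · rintro ⟨p, hp⟩ ⟨p', hp'⟩ h
    exact Subtype.ext (Nat.Partition.ext (congrArg Subtype.val h))
  · rintro ⟨c, h1, h2, h3⟩
    exact ⟨⟨⟨c, fun {a} ha => (Finset.mem_Icc.1 (h1 a ha)).1, h2⟩, (hP _).2 h3⟩, rfl⟩

/-! ### The bijection between `Diff₂*` and column multisets. -/

/-- The rows of a partition in `Diff₂*`, from the list of the multiplicities of `1, 2, …` among
the columns of the reduced diagram. -/
def rows : List ℕ → List ℕ
  | [] => []
  | f :: fs => (f + 2 + (rows fs).headD 0) :: rows fs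

/-- The multiset in which the multiplicities of `1, 2, …` are given by a list. -/
def ofCounts : List ℕ → Multiset ℕ
  | [] => 0
  | f :: fs => (ofCounts fs).map (· + 1) + Multiset.replicate f 1

@[simp] lemma length_rows (fs : List ℕ) : (rows fs).length = fs.length := by
  induction fs with
  | nil => rfl
  | cons f fs ih => simp [rows, ih]

lemma headD_rows (fs : List ℕ) : (rows fs).headD 0 = fs.sum + 2 * fs.length := by
  induction fs with
  | nil => rfl
  | cons f fs ih =>
    simp only [rows, List.headD_cons, List.sum_cons, List.length_cons]
    rw [ih]; ring

lemma two_le_of_mem_rows {fs : List ℕ} {a : ℕ} (ha : a ∈ rows fs) : 2 ≤ a := by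
  induction fs with
  | nil => simp [rows] at ha
  | cons f fs ih =>
    rcases List.mem_cons.1 ha with rfl | h
    · omega
    · exact ih h

lemma isChain_rows (fs : List ℕ) : (rows fs).IsChain (fun a b => b + 2 ≤ a) := by
  induction fs with
  | nil => exact List.isChain_nil
  | cons f fs ih =>
    rw [rows, List.isChain_cons]
    refine ⟨fun y hy => ?_, ih⟩
    rw [List.headD_eq_head?_getD, Option.mem_def.1 hy]
    simp only [Option.getD_some]; omega

/-- Each multiplicity is a row minus the next one minus 2, where the last row is compared with 0;
this is where excluding the part 1 is needed. -/
lemma exists_rows_eq {l : List ℕ} (h : l.IsChain (fun a b => b + 2 ≤ a)) (h2 : ∀ a ∈ l, 2 ≤ a) :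
    ∃ fs, rows fs = l := by
  induction l with
  | nil => exact ⟨[], rfl⟩
  | cons a l ih =>
    rw [List.isChain_cons] at h
    obtain ⟨fs, rfl⟩ := ih h.2 fun b hb => h2 b (List.mem_cons_of_mem _ hb)
    refine ⟨(a - 2 - (rows fs).headD 0) :: fs, ?_⟩
    rw [rows]
    congr 1
    have ha := h2 a List.mem_cons_self
    cases hr : rows fs with
    | nil => simp; omega
    | cons b l =>
      have := h.1 b (by simp [hr])
      simp; omega

/-- The staircase 2 + 4 + ... + 2m accounts for m(m+1). The cardinality is carried along because a
new row lengthens every existing column by one. -/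
lemma sum_rows (fs : List ℕ) :
    (rows fs).sum = (ofCounts fs).sum + fs.length * (fs.length + 1) ∧
      (ofCounts fs).card = fs.sum := by
  induction fs with
  | nil => simp [rows, ofCounts]
  | cons f fs ih =>
    constructor
    · simp only [rows, ofCounts, List.sum_cons, List.length_cons, headD_rows, ih.1,
        Multiset.sum_add, Multiset.sum_map_add, Multiset.map_id', Multiset.map_const',
        Multiset.sum_replicate, ih.2, smul_eq_mul]
      ring
    · simp [ofCounts, ih.2, add_comm]

/-- The list of the reduced parts. -/
def reduceRows (l : List ℕ) : List ℕ := l.mapIdx fun i a => a - 2 * (l.length - i)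

lemma reduceRows_cons (a : ℕ) (l : List ℕ) :
    reduceRows (a :: l) = (a - 2 * (l.length + 1)) :: reduceRows l := by
  simp [reduceRows, List.mapIdx_cons]

lemma foldr_max_reduceRows_rows (fs : List ℕ) : (reduceRows (rows fs)).foldr max 0 = fs.sum := by
  induction fs with
  | nil => rfl
  | cons f fs ih =>
    rw [rows, reduceRows_cons, List.foldr_cons, ih, headD_rows, length_rows, List.sum_cons]
    omega

lemma countP_eq_zero_of_foldr_max_le {l : List ℕ} {j : ℕ} (h : l.foldr max 0 ≤ j) :
    l.countP (fun a => j < a) = 0 := by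
  induction l with
  | nil => rfl
  | cons a l ih =>
    rw [List.foldr_cons] at h
    rw [List.countP_cons, ih (by omega)]
    simp; omega

/-- A new longest row adds a cell to every old column; its overhang consists of columns of length 1.
-/
lemma columns_cons {a : ℕ} {l : List ℕ} (h : l.foldr max 0 ≤ a) :
    columns (a :: l) =
      (columns l).map (· + 1) + Multiset.replicate (a - l.foldr max 0) 1 := by
  simp only [columns, List.foldr_cons, max_eq_left h]
  obtain ⟨d, hd⟩ := Nat.exists_eq_add_of_le h
  rw [Multiset.map_coe, ← Multiset.coe_replicate, Multiset.coe_add]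
  congr 1
  rw [hd, List.range_add, List.map_append, Nat.add_sub_cancel_left]
  congr 1
  · rw [List.map_map]
    refine List.map_congr_left fun j hj => ?_
    have : j < l.foldr max 0 + d := by simp at hj; omega
    simp [this]
  · rw [List.map_map, List.eq_replicate_iff]
    refine ⟨by simp, fun b hb => ?_⟩
    obtain ⟨j, hj, rfl⟩ := List.mem_map.1 hb
    have : l.foldr max 0 + j < l.foldr max 0 + d := by simp at hj; omega
    simp only [Function.comp, List.countP_cons, this, decide_true, if_true]
    rw [countP_eq_zero_of_foldr_max_le (by omega)]

lemma columns_reduceRows_rows (fs : List ℕ) : columns (reduceRows (rows fs)) = ofCounts fs := by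
  induction fs with
  | nil => rfl
  | cons f fs ih =>
    have h := foldr_max_reduceRows_rows fs
    have e : f + 2 + (fs.sum + 2 * fs.length) - 2 * (fs.length + 1) = f + fs.sum := by omega
    rw [rows, reduceRows_cons, headD_rows, length_rows, e, columns_cons (by omega), h, ih, ofCounts,
      Nat.add_sub_cancel]

lemma mem_ofCounts {fs : List ℕ} {a : ℕ} (ha : a ∈ ofCounts fs) : a ∈ Icc 1 fs.length := by
  induction fs generalizing a with
  | nil => simp [ofCounts] at ha
  | cons f fs ih =>
    rw [ofCounts, Multiset.mem_add, Multiset.mem_map] at ha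
    rcases ha with ⟨b, hb, rfl⟩ | ha
    · have := ih hb
      simp at this ⊢; omega
    · rw [Multiset.eq_of_mem_replicate ha]; simp

/-- The lengths must be fixed since trailing zeros leave no trace in the multiset. The count of 1
recovers the head, as the shifted tail contains no 1. -/
lemma ofCounts_injective {fs fs' : List ℕ} (hl : fs.length = fs'.length)
    (h : ofCounts fs = ofCounts fs') : fs = fs' := by
  induction fs generalizing fs' with
  | nil => exact (List.length_eq_zero_iff.1 hl.symm).symm
  | cons f fs ih =>
    rcases fs' with _ | ⟨f', fs'⟩
    · simp at hl
    have hc : ∀ gs : List ℕ, ((ofCounts gs).map (· + 1)).count 1 = 0 := fun gs =>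
      Multiset.count_eq_zero_of_notMem fun hm => by
        obtain ⟨b, hb, hb1⟩ := Multiset.mem_map.1 hm
        have := mem_ofCounts hb
        simp at this; omega
    simp only [ofCounts] at h
    have h1 := congrArg (Multiset.count 1) h
    rw [Multiset.count_add, Multiset.count_add, hc, hc, Multiset.count_replicate_self,
      Multiset.count_replicate_self] at h1
    obtain rfl : f = f' := by omega
    rw [ih (by simpa using hl) (Multiset.map_injective (add_left_injective 1)
      (add_right_cancel h))]

lemma exists_ofCounts_eq (m : ℕ) {c : Multiset ℕ} (hc : ∀ a ∈ c, a ∈ Icc 1 m) :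
    ∃ fs : List ℕ, fs.length = m ∧ ofCounts fs = c := by
  induction m generalizing c with
  | zero =>
    refine ⟨[], rfl, (Multiset.eq_zero_of_forall_notMem fun a ha => ?_).symm⟩
    simpa using hc a ha
  | succ m ih =>
    obtain ⟨fs, hl, h⟩ := ih (c := (c.filter (· ≠ 1)).map (· - 1)) fun a ha => by
      obtain ⟨b, hb, rfl⟩ := Multiset.mem_map.1 ha
      rw [Multiset.mem_filter] at hb
      have := hc b hb.1
      simp at this ⊢; omega
    refine ⟨c.count 1 :: fs, by simp [hl], ?_⟩
    rw [ofCounts, h, Multiset.map_map, Multiset.map_congr rfl (g := id), Multiset.map_id,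
      ← Multiset.filter_eq', add_comm]
    · exact Multiset.filter_add_not _ _
    · intro b hb
      rw [Multiset.mem_filter] at hb
      have := hc b hb.1
      simp at this ⊢; omega

lemma pairwise_rows (fs : List ℕ) : (rows fs).Pairwise (· ≥ ·) :=
  List.isChain_iff_pairwise.1 ((isChain_rows fs).imp fun a b h => by omega)

lemma exists_rows_eq_descParts {N : ℕ} {p : N.Partition} (hp : IsDiff2Star p) :
    ∃ fs, rows fs = descParts p := by
  refine exists_rows_eq hp.1 fun a ha => ?_
  have ha' : a ∈ p.parts := by simpa [descParts] using ha
  have h0 := p.parts_pos ha'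
  have h1 : a ≠ 1 := fun h => hp.2 (h ▸ ha')
  omega

lemma colStar_eq_ofCounts {N : ℕ} {p : N.Partition} {fs : List ℕ} (h : rows fs = descParts p) :
    colStar p = ofCounts fs := by
  rw [← columns_reduceRows_rows, h]; rfl

lemma coe_rows_eq_parts {N : ℕ} {p : N.Partition} {fs : List ℕ} (h : rows fs = descParts p) :
    (rows fs : Multiset ℕ) = p.parts := by
  rw [h, descParts, Multiset.sort_eq]

/-- The partitions in `Diff₂*` with `m` parts and a fixed sum, with conditions on the multiplicities
in `col*`, correspond to the multisets with elements in `[1, m]`. -/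
theorem card_diff2Star_eq_coeff (N m : ℕ) (C : ℕ → ℕ → Prop) :
    (Nat.card {p : N.Partition // IsDiff2Star p ∧ p.parts.card = m ∧
        ∀ i ∈ Icc 1 m, C i ((colStar p).count i)} : ℤ) =
      PowerSeries.coeff N (PowerSeries.X ^ (m * (m + 1)) *
        ∏ i ∈ Icc 1 m, partSeries i (C i)) := by
  have key : ∀ p : N.Partition, IsDiff2Star p → p.parts.card = m →
      ∃ fs, rows fs = descParts p ∧ colStar p = ofCounts fs ∧ fs.length = m ∧
        N = (ofCounts fs).sum + m * (m + 1) := fun p hp hm => by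
    obtain ⟨fs, h⟩ := exists_rows_eq_descParts hp
    have hl : fs.length = m := by
      rw [← hm, ← coe_rows_eq_parts h, Multiset.coe_card, length_rows]
    refine ⟨fs, h, colStar_eq_ofCounts h, hl, ?_⟩
    rw [← p.parts_sum, ← coe_rows_eq_parts h, Multiset.sum_coe, (sum_rows fs).1, hl]
  rw [PowerSeries.coeff_X_pow_mul']
  split_ifs with hN
  · rw [← ncard_restrictedMultisets, Nat.cast_inj, ← Nat.card_coe_set_eq]
    refine Nat.card_eq_of_bijective
      (fun p => ⟨colStar p.1, fun a ha => ?_, ?_, p.2.2.2⟩) ⟨?_, ?_⟩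
    · obtain ⟨fs, -, hfs, hl, -⟩ := key p.1 p.2.1 p.2.2.1
      exact hl ▸ mem_ofCounts (hfs ▸ ha)
    · obtain ⟨fs, -, hfs, -, hs⟩ := key p.1 p.2.1 p.2.2.1
      rw [hfs]; omega
    · rintro ⟨p, hp⟩ ⟨p', hp'⟩ h
      obtain ⟨fs, h1, hfs, hl, -⟩ := key p hp.1 hp.2.1
      obtain ⟨fs', h1', hfs', hl', -⟩ := key p' hp'.1 hp'.2.1
      have hc : colStar p = colStar p' := congrArg Subtype.val h
      obtain rfl := ofCounts_injective (hl.trans hl'.symm) (hfs.symm.trans (hc.trans hfs'))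
      rw [Subtype.mk.injEq, Nat.Partition.ext_iff, ← coe_rows_eq_parts h1, coe_rows_eq_parts h1']
    · rintro ⟨c, hc1, hc2, hc3⟩
      obtain ⟨fs, hl, rfl⟩ := exists_ofCounts_eq m hc1
      let p : N.Partition := ⟨rows fs, fun {a} ha => by
        have := two_le_of_mem_rows (Multiset.mem_coe.1 ha); omega, by
        rw [Multiset.sum_coe, (sum_rows fs).1, hl, hc2]; omega⟩
      have hp : rows fs = descParts p := by
        refine List.Perm.eq_of_pairwise' (r := (· ≥ ·)) (pairwise_rows fs)
          (Multiset.pairwise_sort _ _) ?_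
        rw [← Multiset.coe_eq_coe, descParts, Multiset.sort_eq]
      have hcol := colStar_eq_ofCounts hp
      refine ⟨⟨p, ⟨?_, fun h1 => ?_⟩, ?_, ?_⟩, Subtype.ext hcol⟩
      · rw [IsDiff2, ← hp]; exact isChain_rows fs
      · have := two_le_of_mem_rows (Multiset.mem_coe.1 h1); omega
      · rw [← hl, ← length_rows fs]; rfl
      · rw [hcol]; exact hc3
  · rw [Nat.cast_eq_zero, Nat.card_eq_zero]
    left
    refine ⟨fun p => ?_⟩
    obtain ⟨fs, -, -, -, hs⟩ := key p.1 p.2.1 p.2.2.1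
    omega

end Counting

/-! ### Evaluation of the generating series and comparison with Rogers–Ramanujan. -/

section GeneratingSeries

open PowerSeries

lemma partSeries_step {i : ℕ} (hi : 1 ≤ i) (C : ℕ → Prop) [Decidable (C 0)] :
    partSeries i C = (if C 0 then 1 else 0) + X ^ i * partSeries i fun c => C (c + 1) := by
  classical
  ext t
  rw [map_add, coeff_X_pow_mul', partSeries, partSeries, coeff_mk, coeff_mk]
  rcases Nat.eq_zero_or_pos t with rfl | ht
  · rw [if_neg (show ¬ i ≤ 0 by omega)]
    by_cases h : C 0 <;> simp [h]
  have h0 : coeff t (if C 0 then (1 : PowerSeries ℤ) else 0) = 0 := by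
    split_ifs <;> simp [coeff_one, ht.ne']
  rw [h0, zero_add]
  by_cases hit : i ≤ t
  · obtain ⟨d, rfl⟩ := Nat.exists_eq_add_of_le hit
    simp only [if_pos hit, Nat.add_sub_cancel_left, Nat.add_div_left _ hi,
      Nat.dvd_add_right (dvd_refl i)]
  · rw [if_neg hit, if_neg]
    exact fun h => hit (Nat.le_of_dvd ht h.1)

open Classical in
lemma partSeries_split {i : ℕ} (hi : 1 ≤ i) (C : ℕ → Prop) (p : ℕ) :
    partSeries i C = ∑ s ∈ range p, (if C s then X ^ (i * s) else 0) +
      X ^ (i * p) * partSeries i fun c => C (c + p) := by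
  induction p with
  | zero => simp
  | succ p ih =>
    rw [ih, Finset.sum_range_succ, partSeries_step hi fun c => C (c + p)]
    simp only [zero_add, add_assoc, add_comm 1 p]
    split_ifs <;> ring

lemma partSeries_false (i : ℕ) : partSeries i (fun _ => False) = 0 := by
  ext; simp [partSeries]

open Classical in
lemma partSeries_of_bounded {i : ℕ} (hi : 1 ≤ i) {C : ℕ → Prop} {p : ℕ} (h : ∀ c, C c → c < p) :
    partSeries i C = ∑ s ∈ range p, if C s then X ^ (i * s) else 0 := by
  have : (fun c => C (c + p)) = fun _ => False := by
    ext c; exact iff_of_false (fun hc => by have := h _ hc; omega) id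
  rw [partSeries_split hi C p, this, partSeries_false, mul_zero, add_zero]

open Classical in
lemma partSeries_of_periodic {i : ℕ} (hi : 1 ≤ i) {C : ℕ → Prop} {p : ℕ}
    (h : ∀ c, C (c + p) ↔ C c) :
    partSeries i C * (1 - X ^ (i * p)) = ∑ s ∈ range p, if C s then X ^ (i * s) else 0 := by
  have h1 := partSeries_split hi C p
  rw [show (fun c => C (c + p)) = C from funext fun c => propext (h c)] at h1
  linear_combination h1

lemma partSeries_true {i : ℕ} (hi : 1 ≤ i) {C : ℕ → Prop} (h : ∀ c, C c) :
    partSeries i C * (1 - X ^ i) = 1 := by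
  have := partSeries_of_periodic hi (C := C) (p := 1) (by simp [h])
  simpa [h] using this

lemma partSeries_zero {i : ℕ} (hi : 1 ≤ i) {C : ℕ → Prop} (h : ∀ c, C c ↔ c = 0) :
    partSeries i C = 1 := by
  have := partSeries_of_bounded hi (C := C) (p := 1) (by simp [h])
  simpa [h] using this

/-- The condition on the multiplicity `c` of `i` in `col*` of a partition with `m` parts. -/
def ColCondition (m i c : ℕ) : Prop :=
  (8 ≤ m ∧ (i = 3 ∨ i = 8 → c = 0)) ∨
  (5 ≤ m ∧ m ≤ 7 ∧ (i = 4 → c ≤ 1) ∧ (i = 3 → c = 0)) ∨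
  (m = 4 ∧ (i = 4 → c = 0) ∧ (i = 3 → c ≤ 2) ∧
    (i = 1 → c ≡ 2 [MOD 7] ∨ c ≡ 3 [MOD 7] ∨ c ≡ 4 [MOD 7])) ∨
  (m = 3 ∧ (i = 3 → c = 0) ∧ (i = 1 → ¬ c ≡ 3 [MOD 7] ∧ ¬ c ≡ 4 [MOD 7])) ∨
  (m = 2 ∧ (i = 1 → c = 1)) ∨
  (m = 1 ∧ Even c)

/-- The generating series of `col*` for the partitions with `m` parts. -/
noncomputable def colSeries (m : ℕ) : PowerSeries ℤ :=
  ∏ i ∈ Icc 1 m, partSeries i (ColCondition m i)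

lemma qprod_zero_eq {R : Type*} [CommRing R] (q : R) (m : ℕ) :
    qprod q 0 m = ∏ i ∈ Icc 1 m, (1 - q ^ i) := rfl

/-- For m ≥ 8 only the missing 3 and 8 leave a factor. For m ≤ 7 the factor 1-X^8 arises as
(1+X^4)(1-X^4), from allowing at most one 4. -/
lemma colSeries_mul (m : ℕ) (hm : 5 ≤ m) :
    colSeries m * qprod X 0 m = (1 - X ^ 3) * (1 - X ^ 8) := by
  rw [colSeries, qprod_zero_eq, ← Finset.prod_mul_distrib]
  by_cases h8 : 8 ≤ m
  · have hC : ∀ i c, ColCondition m i c ↔ (i = 3 ∨ i = 8 → c = 0) := fun i c => by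
      unfold ColCondition; omega
    rw [← Finset.prod_subset (s₁ := {3, 8}) (by intro i hi; simp at hi ⊢; omega)]
    · rw [Finset.prod_pair (by norm_num), partSeries_zero (by norm_num) (by simp [hC]),
        partSeries_zero (by norm_num) (by simp [hC]), one_mul, one_mul]
    · intro i hi hi'
      refine partSeries_true (by simp at hi; omega) fun c => ?_
      rw [hC]
      simp at hi'; omega
  · have hC : ∀ i c, ColCondition m i c ↔ (i = 4 → c ≤ 1) ∧ (i = 3 → c = 0) := fun i c => by
      unfold ColCondition; omega
    rw [← Finset.prod_subset (s₁ := {3, 4}) (by intro i hi; simp at hi ⊢; omega)]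
    · have h4 := partSeries_of_bounded (i := 4) (C := ColCondition m 4) (p := 2) (by norm_num)
        fun c hc => Nat.lt_succ_of_le (((hC 4 c).1 hc).1 rfl)
      simp only [hC, Finset.sum_range_succ, Finset.sum_range_zero] at h4
      norm_num at h4
      rw [Finset.prod_pair (by norm_num), partSeries_zero (by norm_num) (by simp [hC]), h4]
      ring
    · intro i hi hi'
      refine partSeries_true (by simp at hi; omega) fun c => ?_
      rw [hC]
      simp at hi'; omega

lemma colSeries_one : colSeries 1 * (1 - X ^ 2) = 1 := by
  have hC : ∀ i c, ColCondition 1 i c ↔ Even c := fun i c => by simp [ColCondition]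
  have h := partSeries_of_periodic (C := ColCondition 1 1) (p := 2) le_rfl
    (by simp [hC, Nat.even_add])
  simp only [colSeries, Icc_self, Finset.prod_singleton]
  simpa [hC, Finset.sum_range_succ] using h

lemma colSeries_two : colSeries 2 * (1 - X ^ 2) = X := by
  have hC : ∀ i c, ColCondition 2 i c ↔ (i = 1 → c = 1) := fun i c => by simp [ColCondition]
  have h1 := partSeries_of_bounded (C := ColCondition 2 1) (p := 2) le_rfl (by simp [hC])
  have h2 := partSeries_true (i := 2) (C := ColCondition 2 2) (by norm_num) (by simp [hC])
  simp [hC] at h1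
  rw [colSeries, Finset.prod_Icc_succ_top (by norm_num), Icc_self, Finset.prod_singleton,
    mul_assoc, h2, mul_one, h1]

lemma colSeries_three :
    colSeries 3 * ((1 - X ^ 2) * (1 - X ^ 7)) = 1 + X + X ^ 2 + X ^ 5 + X ^ 6 := by
  have hC : ∀ i c, ColCondition 3 i c ↔
      (i = 3 → c = 0) ∧ (i = 1 → ¬ c ≡ 3 [MOD 7] ∧ ¬ c ≡ 4 [MOD 7]) := fun i c => by
    simp [ColCondition]
  have h1 := partSeries_of_periodic (C := ColCondition 3 1) (p := 7) le_rfl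
    (by simp [hC, Nat.ModEq])
  have h2 := partSeries_true (i := 2) (C := ColCondition 3 2) (by norm_num) (by simp [hC])
  have h3 := partSeries_zero (i := 3) (C := ColCondition 3 3) (by norm_num) (by simp [hC])
  simp [hC, Finset.sum_range_succ, Nat.ModEq] at h1
  rw [colSeries, Finset.prod_Icc_succ_top (by norm_num), Finset.prod_Icc_succ_top (by norm_num),
    Icc_self, Finset.prod_singleton, h3]
  linear_combination (partSeries 1 (ColCondition 3 1)) * (1 - X ^ 7) * h2 + h1

lemma colSeries_four :
    colSeries 4 * ((1 - X ^ 2) * (1 - X ^ 7)) =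
      (1 + X ^ 3 + X ^ 6) * (X ^ 2 + X ^ 3 + X ^ 4) := by
  have hC : ∀ i c, ColCondition 4 i c ↔ (i = 4 → c = 0) ∧ (i = 3 → c ≤ 2) ∧
      (i = 1 → c ≡ 2 [MOD 7] ∨ c ≡ 3 [MOD 7] ∨ c ≡ 4 [MOD 7]) := fun i c => by
    simp [ColCondition]
  have h1 := partSeries_of_periodic (C := ColCondition 4 1) (p := 7) le_rfl
    (by simp [hC, Nat.ModEq])
  have h2 := partSeries_true (i := 2) (C := ColCondition 4 2) (by norm_num) (by simp [hC])
  have h3 := partSeries_of_bounded (i := 3) (C := ColCondition 4 3) (p := 3) (by norm_num)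
    (by simp [hC]; omega)
  have h4 := partSeries_zero (i := 4) (C := ColCondition 4 4) (by norm_num) (by simp [hC])
  simp [hC, Finset.sum_range_succ, Nat.ModEq] at h1 h3
  rw [colSeries, Finset.prod_Icc_succ_top (by norm_num), Finset.prod_Icc_succ_top (by norm_num),
    Finset.prod_Icc_succ_top (by norm_num), Icc_self, Finset.prod_singleton, h4, h3]
  linear_combination (1 + X ^ 3 + X ^ 6) * (partSeries 1 (ColCondition 4 1)) * (1 - X ^ 7) * h2 +
    (1 + X ^ 3 + X ^ 6) * h1

lemma one_sub_X_pow_ne_zero {k : ℕ} (hk : k ≠ 0) : (1 - X ^ k : PowerSeries ℤ) ≠ 0 := fun h => by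
  have := congrArg constantCoeff h
  simp [hk] at this

/-- The initial terms of the generating series. -/
lemma qprod_mul_initial : qprod (X : PowerSeries ℤ) 0 4 *
      (1 + ∑ m ∈ Icc 1 4, X ^ (m * (m + 1)) * colSeries m) =
    (1 - X ^ 3) * (1 - X ^ 8) * ∑ n ∈ range 5, X ^ (n ^ 2 + 1 * n) * qprod X n 4 := by
  -- 1-X^2 and 1-X^7 are the denominators of the four column series; clearing them leaves a
  -- polynomial identity.
  refine mul_right_cancel₀ (mul_ne_zero (one_sub_X_pow_ne_zero two_ne_zero)
    (one_sub_X_pow_ne_zero (show 7 ≠ 0 by norm_num))) ?_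
  have h1 := colSeries_one
  have h2 := colSeries_two
  have h3 := colSeries_three
  have h4 := colSeries_four
  simp only [qprod, Finset.sum_range_succ, Finset.sum_range_zero,
    Finset.sum_Icc_succ_top (show 1 ≤ 3 + 1 by norm_num),
    Finset.sum_Icc_succ_top (show 1 ≤ 2 + 1 by norm_num),
    Finset.sum_Icc_succ_top (show 1 ≤ 1 + 1 by norm_num), Icc_self, Finset.sum_singleton,
    Finset.prod_Ioc_succ_top (show 0 ≤ 3 by norm_num),
    Finset.prod_Ioc_succ_top (show 0 ≤ 2 by norm_num),
    Finset.prod_Ioc_succ_top (show 0 ≤ 1 by norm_num),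
    Finset.prod_Ioc_succ_top (show 0 ≤ 0 by norm_num),
    Finset.prod_Ioc_succ_top (show 1 ≤ 3 by norm_num),
    Finset.prod_Ioc_succ_top (show 1 ≤ 2 by norm_num),
    Finset.prod_Ioc_succ_top (show 1 ≤ 1 by norm_num),
    Finset.prod_Ioc_succ_top (show 2 ≤ 3 by norm_num),
    Finset.prod_Ioc_succ_top (show 2 ≤ 2 by norm_num),
    Finset.prod_Ioc_succ_top (show 3 ≤ 3 by norm_num), Ioc_self, Finset.prod_empty,
    Nat.reduceAdd, Nat.reduceMul, Nat.reducePow]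
  generalize colSeries 1 = c1 at *
  generalize colSeries 2 = c2 at *
  generalize colSeries 3 = c3 at *
  generalize colSeries 4 = c4 at *
  generalize (X : PowerSeries ℤ) = x at *
  linear_combination (1 - x) * (1 - x ^ 2) * (1 - x ^ 3) * (1 - x ^ 4) *
    (x ^ 2 * (1 - x ^ 7) * h1 + x ^ 6 * (1 - x ^ 7) * h2 + x ^ 12 * h3 + x ^ 20 * h4)

/-- The terms up to 4 match only in total, so they form the base case; beyond that, `colSeries_mul`
matches them one by one. -/
lemma qprod_mul_series {M : ℕ} (hM : 4 ≤ M) : qprod (X : PowerSeries ℤ) 0 M *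
      (1 + ∑ m ∈ Icc 1 M, X ^ (m * (m + 1)) * colSeries m) =
    (1 - X ^ 3) * (1 - X ^ 8) * sumSide X M 1 := by
  induction M, hM using Nat.le_induction with
  | base => exact qprod_mul_initial
  | succ M hM ih =>
    have hs : sumSide (X : PowerSeries ℤ) (M + 1) 1 = sumSide X M 1 * (1 - X ^ (M + 1)) +
        X ^ ((M + 1) ^ 2 + 1 * (M + 1)) := by
      rw [sumSide, Finset.sum_range_succ, qprod_self, mul_one, sumSide, Finset.sum_mul]
      congr 1
      refine Finset.sum_congr rfl fun n hn => ?_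
      rw [qprod_succ_top _ (by simp at hn; omega), mul_assoc]
    have hc := colSeries_mul (M + 1) (by omega)
    rw [hs, Finset.sum_Icc_succ_top (by omega)]
    rw [qprod_succ_top _ (Nat.zero_le M)] at hc ⊢
    rw [show (M + 1) ^ 2 + 1 * (M + 1) = (M + 1) * (M + 1 + 1) by ring]
    linear_combination (1 - X ^ (M + 1)) * ih + X ^ ((M + 1) * (M + 1 + 1)) * hc

/-- The condition on the multiplicity `c` of the part `i` in the partitions with parts congruent
to `2` or `3` modulo `5`, different from `3` and `8`. -/
def PartCondition (i c : ℕ) : Prop :=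
  ((i ≡ 2 [MOD 5] ∨ i ≡ 3 [MOD 5]) ∧ i ≠ 3 ∧ i ≠ 8) ∨ c = 0

lemma prod_not_two_three (J : ℕ) :
    ∏ i ∈ Icc 1 (5 * J), (if i ≡ 2 [MOD 5] ∨ i ≡ 3 [MOD 5] then 1 else 1 - X ^ i) =
      (∏ i ∈ range J, (1 - X ^ (5 * i + 4))) * (∏ i ∈ range J, (1 - X ^ (5 * i + 1))) *
        qprod ((X : PowerSeries ℤ) ^ 5) 0 J := by
  induction J with
  | zero => simp
  | succ J ih =>
    rw [show 5 * (J + 1) = 5 * J + 1 + 1 + 1 + 1 + 1 by ring]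
    iterate 5 rw [Finset.prod_Icc_succ_top (by omega)]
    rw [ih, Finset.prod_range_succ, Finset.prod_range_succ, qprod_succ_top _ (Nat.zero_le J),
      if_neg, if_pos, if_pos, if_neg, if_neg]
    · ring
    all_goals simp only [Nat.ModEq]; omega

/-- Compared factor by factor: multiplication by 1-X^i gives 1 for an allowed part and 1-X^i for a
forbidden one. J ≥ 2 brings 8 into range. -/
lemma prod_partSeries_mul {J : ℕ} (hJ : 2 ≤ J) :
    (∏ i ∈ Icc 1 (5 * J), partSeries i (PartCondition i)) * qprod X 0 (5 * J) =
      (1 - X ^ 3) * (1 - X ^ 8) * ((∏ i ∈ range J, (1 - X ^ (5 * i + 4))) *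
        (∏ i ∈ range J, (1 - X ^ (5 * i + 1))) * qprod (X ^ 5) 0 J) := by
  have h38 : ∏ i ∈ Icc 1 (5 * J), (if i = 3 ∨ i = 8 then 1 - (X : PowerSeries ℤ) ^ i else 1) =
      (1 - X ^ 3) * (1 - X ^ 8) := by
    rw [← Finset.prod_subset (s₁ := {3, 8}) (by intro i hi; simp at hi ⊢; omega)]
    · rw [Finset.prod_pair (by norm_num)]; simp
    · intro i _ hi
      rw [if_neg (by simpa using hi)]
  rw [← prod_not_two_three, ← h38, qprod_zero_eq, ← Finset.prod_mul_distrib,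
    ← Finset.prod_mul_distrib]
  refine Finset.prod_congr rfl fun i hi => ?_
  have hi1 : 1 ≤ i := (Finset.mem_Icc.1 hi).1
  by_cases h : i ≡ 2 [MOD 5] ∨ i ≡ 3 [MOD 5]
  · rw [if_pos h, mul_one]
    by_cases h' : i = 3 ∨ i = 8
    · rw [if_pos h', partSeries_zero hi1 fun c => ?_, one_mul]
      unfold PartCondition; omega
    · rw [if_neg h', partSeries_true hi1 fun c => ?_]
      exact Or.inl ⟨h, by omega⟩
  · have h' : ¬ (i = 3 ∨ i = 8) := by
      rintro (rfl | rfl) <;> simp [Nat.ModEq] at h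
    rw [if_neg h, if_neg h', partSeries_zero hi1 fun c => ?_]
    simp [PartCondition, h]

lemma map_qprod {R S : Type*} [CommRing R] [CommRing S] (φ : R →+* S) (q : R) (a b : ℕ) :
    φ (qprod q a b) = qprod (φ q) a b := by simp [qprod]

lemma map_sumSide {R S : Type*} [CommRing R] [CommRing S] (φ : R →+* S) (q : R) (M i : ℕ) :
    φ (sumSide q M i) = sumSide (φ q) M i := by simp [sumSide, map_qprod]

theorem coeff_prod_partSeries {N M : ℕ} (hN : 1 ≤ N) (hM : M = 5 * (2 * (N + 1) + 1)) :
    coeff N (∏ i ∈ Icc 1 M, partSeries i (PartCondition i)) =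
      ∑ m ∈ Icc 1 M, coeff N (X ^ (m * (m + 1)) * colSeries m) := by
  let I : Ideal (PowerSeries ℤ) := Ideal.span {X ^ (N + 1)}
  let φ := Ideal.Quotient.mk I
  have hq : φ X ^ (N + 1) = 0 := by
    rw [← map_pow, Ideal.Quotient.eq_zero_iff_mem]
    exact Ideal.mem_span_singleton_self _
  have hRR := sumSide_one hq (M := M) (K := 2 * (N + 1)) (by omega) (by omega) le_rfl
  have hq5 : (φ X ^ 5) ^ (N + 1) = 0 := by
    rw [← pow_mul, mul_comm, pow_mul, hq, zero_pow (by norm_num)]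
  -- The triple product has one more factor of type 5i+1 than of type 5i+4; the extra one is 1
  -- modulo X^(N+1).
  rw [Finset.prod_range_succ _ (2 * (N + 1) + 1), pow_eq_zero_of_le (by omega) hq, sub_zero,
    mul_one, qprod_eq_of_le hq5 (Nat.zero_le (2 * (N + 1) + 1)) (by omega) (by omega)] at hRR
  have h1 := congrArg φ (prod_partSeries_mul (J := 2 * (N + 1) + 1) (by omega))
  have h2 := congrArg φ (qprod_mul_series (M := M) (by omega))
  rw [← hM] at h1
  simp only [map_mul, map_qprod, map_sumSide, hRR, map_prod, map_sub, map_pow, map_one] at h1 h2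
  rw [← h2, mul_comm] at h1
  have h3 := (isUnit_qprod hq 0 M).mul_left_cancel h1
  rw [← map_prod, Ideal.Quotient.eq, Ideal.mem_span_singleton,
    X_pow_dvd_iff] at h3
  have h4 := h3 N (Nat.lt_succ_self N)
  rw [map_sub, sub_eq_zero] at h4
  -- The summand 1 is the empty partition, invisible in degree N ≥ 1.
  rw [h4, map_add, coeff_one, if_neg (by omega), zero_add, map_sum]

end GeneratingSeries

/-! ### Translation of both counts into coefficients. -/

theorem card_allowed_parts {N M : ℕ} (hM : N ≤ M) :
    (Nat.card {p : N.Partition //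
      (∀ a ∈ p.parts, a ≡ 2 [MOD 5] ∨ a ≡ 3 [MOD 5]) ∧ 3 ∉ p.parts ∧ 8 ∉ p.parts} : ℤ) =
      PowerSeries.coeff N (∏ i ∈ Icc 1 M, partSeries i (PartCondition i)) := by
  refine card_partitions_eq_coeff hM PartCondition fun p => ⟨fun h i _ => ?_, fun h => ?_⟩
  · by_cases hi : i ∈ p.parts
    · exact Or.inl ⟨h.1 i hi, fun h3 => h.2.1 (h3 ▸ hi), fun h8 => h.2.2 (h8 ▸ hi)⟩
    · exact Or.inr (Multiset.count_eq_zero_of_notMem hi)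
  · have key : ∀ a ∈ p.parts, (a ≡ 2 [MOD 5] ∨ a ≡ 3 [MOD 5]) ∧ a ≠ 3 ∧ a ≠ 8 := fun a ha =>
      (h a (Finset.mem_Icc.2 ⟨p.parts_pos ha, (p.le_of_mem_parts ha).trans hM⟩)).resolve_right
        (Multiset.count_ne_zero.2 ha)
    exact ⟨fun a ha => (key a ha).1, fun h3 => (key 3 h3).2.1 rfl, fun h8 => (key 8 h8).2.2 rfl⟩

/-- The restrictions on the partitions in `Diff₂*` in the main theorem. -/
def Admissible {N : ℕ} (p : N.Partition) : Prop :=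
  (8 ≤ p.parts.card ∧ (colStar p).count 3 = 0 ∧ (colStar p).count 8 = 0) ∨
  (5 ≤ p.parts.card ∧ p.parts.card ≤ 7 ∧ (colStar p).count 4 ≤ 1 ∧ (colStar p).count 3 = 0) ∨
  (p.parts.card = 4 ∧ (colStar p).count 4 = 0 ∧ (colStar p).count 3 ≤ 2 ∧
    ((colStar p).count 1 ≡ 2 [MOD 7] ∨ (colStar p).count 1 ≡ 3 [MOD 7] ∨
      (colStar p).count 1 ≡ 4 [MOD 7])) ∨
  (p.parts.card = 3 ∧ (colStar p).count 3 = 0 ∧ ¬ (colStar p).count 1 ≡ 3 [MOD 7] ∧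
    ¬ (colStar p).count 1 ≡ 4 [MOD 7]) ∨
  (p.parts.card = 2 ∧ (colStar p).count 1 = 1) ∨
  (p.parts.card = 1 ∧ ∀ a ∈ p.parts, Even a)

lemma count_colStar_of_card_eq_one {N : ℕ} {p : N.Partition} (hp : IsDiff2Star p)
    (h : p.parts.card = 1) : p.parts = {(colStar p).count 1 + 2} := by
  obtain ⟨fs, hfs⟩ := exists_rows_eq_descParts hp
  have hl : fs.length = 1 := by
    rw [← h, ← coe_rows_eq_parts hfs, Multiset.coe_card, length_rows]
  obtain ⟨f, rfl⟩ := List.length_eq_one_iff.1 hl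
  rw [← coe_rows_eq_parts hfs, colStar_eq_ofCounts hfs]
  simp [rows, ofCounts]

lemma admissible_iff {N m : ℕ} {p : N.Partition} (hp : IsDiff2Star p) (hm : p.parts.card = m)
    (h1 : 1 ≤ m) :
    Admissible p ↔ ∀ i ∈ Icc 1 m, ColCondition m i ((colStar p).count i) := by
  subst hm
  -- A single part exceeds its number of columns by 2, so the parities agree.
  have hone : p.parts.card = 1 → ((∀ a ∈ p.parts, Even a) ↔ Even ((colStar p).count 1)) := by
    intro h
    have hparts := count_colStar_of_card_eq_one hp h
    generalize (colStar p).count 1 = c at *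
    rw [hparts]
    simp [Nat.even_add]
  constructor
  · intro h i hi
    rcases h with h | h | h | h | h | h
    · refine Or.inl ⟨h.1, ?_⟩
      rintro (rfl | rfl)
      exacts [h.2.1, h.2.2]
    · refine Or.inr (Or.inl ⟨h.1, h.2.1, ?_, ?_⟩) <;> rintro rfl
      exacts [h.2.2.1, h.2.2.2]
    · refine Or.inr (Or.inr (Or.inl ⟨h.1, ?_, ?_, ?_⟩)) <;> rintro rfl
      exacts [h.2.1, h.2.2.1, h.2.2.2]
    · refine Or.inr (Or.inr (Or.inr (Or.inl ⟨h.1, ?_, ?_⟩))) <;> rintro rfl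
      exacts [h.2.1, h.2.2]
    · refine Or.inr (Or.inr (Or.inr (Or.inr (Or.inl ⟨h.1, ?_⟩))))
      rintro rfl
      exact h.2
    · obtain rfl : i = 1 := by simp at hi; omega
      exact Or.inr (Or.inr (Or.inr (Or.inr (Or.inr ⟨h.1, (hone h.1).1 h.2⟩))))
  · intro h
    have hi : ∀ i, 1 ≤ i → i ≤ p.parts.card →
        ColCondition p.parts.card i ((colStar p).count i) := fun i h1 h2 =>
      h i (Finset.mem_Icc.2 ⟨h1, h2⟩)
    have hi1 := hi 1 le_rfl h1
    rcases hi1 with h | h | h | h | h | h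
    · have h3 := hi 3 (by norm_num) (by omega)
      have h8 := hi 8 (by norm_num) (by omega)
      unfold ColCondition at h3 h8
      exact Or.inl ⟨h.1, by omega, by omega⟩
    · have h3 := hi 3 (by norm_num) (by omega)
      have h4 := hi 4 (by norm_num) (by omega)
      unfold ColCondition at h3 h4
      exact Or.inr (Or.inl ⟨h.1, h.2.1, by omega, by omega⟩)
    · have h3 := hi 3 (by norm_num) (by omega)
      have h4 := hi 4 (by norm_num) (by omega)
      unfold ColCondition at h3 h4
      exact Or.inr (Or.inr (Or.inl ⟨h.1, by omega, by omega, h.2.2.2 rfl⟩))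
    · have h3 := hi 3 (by norm_num) (by omega)
      unfold ColCondition at h3
      exact Or.inr (Or.inr (Or.inr (Or.inl ⟨h.1, by omega, h.2.2 rfl⟩)))
    · exact Or.inr (Or.inr (Or.inr (Or.inr (Or.inl ⟨h.1, h.2 rfl⟩))))
    · exact Or.inr (Or.inr (Or.inr (Or.inr (Or.inr ⟨h.1, (hone h.1).2 h.2⟩))))

lemma card_admissible {N M : ℕ} (hN : 1 ≤ N) (hM : N ≤ M) :
    (Nat.card {p : N.Partition // IsDiff2Star p ∧ Admissible p} : ℤ) =
      ∑ m ∈ Icc 1 M, PowerSeries.coeff N (PowerSeries.X ^ (m * (m + 1)) * colSeries m) := by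
  classical
  have hcard : ∀ p : N.Partition, p.parts.card ∈ Icc 1 M := fun p => by
    have h1 : p.parts.card • 1 ≤ p.parts.sum :=
      Multiset.card_nsmul_le_sum fun a ha => p.parts_pos ha
    rw [p.parts_sum, smul_eq_mul, mul_one] at h1
    refine Finset.mem_Icc.2 ⟨Nat.pos_of_ne_zero fun h0 => ?_, h1.trans hM⟩
    have := p.parts_sum
    rw [Multiset.card_eq_zero.1 h0, Multiset.sum_zero] at this
    omega
  rw [Nat.card_eq_fintype_card, Fintype.card_subtype,
    Finset.card_eq_sum_card_fiberwise (f := fun p : N.Partition => p.parts.card) (t := Icc 1 M)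
      fun p _ => hcard p, Nat.cast_sum]
  refine Finset.sum_congr rfl fun m hm => ?_
  rw [colSeries, ← card_diff2Star_eq_coeff, Nat.card_eq_fintype_card, Fintype.card_subtype,
    Finset.filter_filter]
  congr 2
  refine Finset.filter_congr fun p _ => ?_
  constructor
  · rintro ⟨⟨h1, h2⟩, h3⟩
    exact ⟨h1, h3, (admissible_iff h1 h3 (Finset.mem_Icc.1 hm).1).1 h2⟩
  · rintro ⟨h1, h3, h2⟩
    exact ⟨⟨h1, (admissible_iff h1 h3 (Finset.mem_Icc.1 hm).1).2 h2⟩, h3⟩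

end RogersRamanujan

theorem mainTheorem12 (N : ℕ) (hN : 1 ≤ N) :
    Nat.card {p : N.Partition //
        (∀ a ∈ p.parts, a ≡ 2 [MOD 5] ∨ a ≡ 3 [MOD 5]) ∧ 3 ∉ p.parts ∧ 8 ∉ p.parts} =
      Nat.card {p : N.Partition //
        RogersRamanujan.IsDiff2Star p ∧
          ((8 ≤ p.parts.card ∧
              (RogersRamanujan.colStar p).count 3 = 0 ∧
              (RogersRamanujan.colStar p).count 8 = 0) ∨
            (5 ≤ p.parts.card ∧ p.parts.card ≤ 7 ∧
              (RogersRamanujan.colStar p).count 4 ≤ 1 ∧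
              (RogersRamanujan.colStar p).count 3 = 0) ∨
            (p.parts.card = 4 ∧
              (RogersRamanujan.colStar p).count 4 = 0 ∧
              (RogersRamanujan.colStar p).count 3 ≤ 2 ∧
              ((RogersRamanujan.colStar p).count 1 ≡ 2 [MOD 7] ∨
                (RogersRamanujan.colStar p).count 1 ≡ 3 [MOD 7] ∨
                (RogersRamanujan.colStar p).count 1 ≡ 4 [MOD 7])) ∨
            (p.parts.card = 3 ∧
              (RogersRamanujan.colStar p).count 3 = 0 ∧
              ¬ (RogersRamanujan.colStar p).count 1 ≡ 3 [MOD 7] ∧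
              ¬ (RogersRamanujan.colStar p).count 1 ≡ 4 [MOD 7]) ∨
            (p.parts.card = 2 ∧ (RogersRamanujan.colStar p).count 1 = 1) ∨
            (p.parts.card = 1 ∧ ∀ a ∈ p.parts, Even a))} := by
  have h := RogersRamanujan.card_admissible (N := N) (M := 5 * (2 * (N + 1) + 1)) hN (by omega)
  rw [← RogersRamanujan.coeff_prod_partSeries hN rfl,
    ← RogersRamanujan.card_allowed_parts (by omega), Nat.cast_inj] at h
  exact h.symm
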